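/- Let $L\ge 1$. For $a>0$, $b\in\mathbb{R}\setminus\{0\}$ and $m\in\mathbb{R}$, the Pearson type III distribution with parameters $(a,b,m)$ is the distribution on $\mathbb{R}$ with density $$f(x;a,b,m)=\frac{|b|}{\Gamma(a)}\,\bigl(b(x-m)\bigr)^{a-1}e^{-b(x-m)}\quad\text{if } b(x-m)>0,\qquad f(x;a,b,m)=0\quad\text{otherwise.}$$ Let $X_1,\dots,X_L$ be independent random variables, $X_i$ following the Pearson type III distribution with parameters $(a_i,b_i,m_i)$, where the $a_i$ are positive integers and either $b_i>0$ for all $i$ or $b_i<0$ for all $i$. Put $SX_L=\sum_{i=1}^L X_i$, $sa_L=\sum_{i=1}^L a_i$ and $sm_L=\sum_{i=1}^L m_i$. 1. If $b_i=b$ for all $i$, then $SX_L$ follows the Pearson type III distribution with parameters $(sa_L,b,sm_L)$. 2. If $b_i\ne b_j$ for all $i\ne j$, then $SX_L$ has the probability density function $$f_{SX_L}(x)=\sum_{i=1}^{L}\sum_{k=1}^{a_i}\Xi_L^0(i,k)\,f(x;k,b_i,sm_L),$$ where, with $e_i(1)<\dots<e_i(L-1)$ denoting the elements of $\{1,\dots,L\}\setminus\{i\}$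 (that is, $e_i(s)=s$ for $s<i$ and $e_i(s)=s+1$ for $s\ge i$), $$\Xi_L^0(i,k)=\sum_{(j_0,\dots,j_{L-1})}(-1)^{sa_L-a_i}\,\frac{\prod_{w=1}^{L}b_w^{a_w}}{b_i^{k}}\prod_{s=1}^{L-1}\frac{(j_{s-1}+a_{e_i(s)}-j_s-1)!}{(a_{e_i(s)}-1)!\,(j_{s-1}-j_s)!}\,(b_i-b_{e_i(s)})^{j_s-j_{s-1}-a_{e_i(s)}},$$ the sum running over all integer chains $a_i=j_0\ge j_1\ge\dots\ge j_{L-2}\ge j_{L-1}=k$ (that is, over $j_1=k,\dots,a_i$, then $j_2=k,\dots,j_1$, and so on up to $j_{L-2}=k,\dots,j_{L-3}$; for $L=2$ there is one term, and for $L=1$ the weight is $1$ if $k=a_1$ and $0$ otherwise). Moreover, in case 2 these weights satisfy, for every $i$, $$\Xi_L^0(i,a_i)=\frac{\prod_{w=1}^{L}b_w^{a_w}}{b_i^{a_i}}\prod_{\substack{j=1\\ j\ne i}}^{L}(b_j-b_i)^{-a_j}$$ and, for $1\le k<a_i$, the recursion $$\Xi_L^0(i,a_i-k)=\frac1k\sum_{j=1}^{k}\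 \sum_{\substack{q=1\\ q\ne i}}^{L}a_q\,b_i^{\,j}\,(b_i-b_q)^{-j}\,\Xi_L^0(i,a_i-k+j).$$ -/

import Mathlib

open MeasureTheory ProbabilityTheory
open scoped Nat

noncomputable section

/-- Density of the Pearson type III distribution with shape `a > 0`, inverse scale `b ≠ 0` and
shift `m`. Its support `0 < b * (x - m)` is `(m, ∞)` if `b > 0` and `(-∞, m)` if `b < 0`. -/
def pearsonPDF (a b m x : ℝ) : ℝ :=
  if 0 < b * (x - m) then
    |b| / Real.Gamma a * (b * (x - m)) ^ (a - 1) * Real.exp (-(b * (x - m)))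
  else 0

/-- The real random variable `X` has the probability density function `f` (with respect to
Lebesgue measure). As `f` is required to be nonnegative, `ENNReal.ofReal` loses nothing. -/
def HasRealPDF {Ω : Type*} [MeasurableSpace Ω] (X : Ω → ℝ) (f : ℝ → ℝ) (P : Measure Ω) : Prop :=
  Measurable f ∧ (∀ x, 0 ≤ f x) ∧
    HasLaw X (volume.withDensity fun x => ENNReal.ofReal (f x)) P

/-- `X` follows the Pearson type III distribution with parameters `(a, b, m)`. -/
def IsPearson {Ω : Type*} [MeasurableSpace Ω] (X : Ω → ℝ) (a b m : ℝ) (P : Measure Ω) : Prop :=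
  0 < a ∧ b ≠ 0 ∧ HasRealPDF X (pearsonPDF a b m) P

/-- The index set of the nested sum over `j₁, …, j_{L-2}` with `L = n + 1`: all chains
`A = j₀ ≥ j₁ ≥ ⋯ ≥ j_{L-2} ≥ j_{L-1} = k`, whose two end points are fixed. For `L = 2` there is
just the chain `(A, k)` (if `k ≤ A`), and for `L = 1` the chain exists only if `k = A`. -/
def chains (n A k : ℕ) : Finset (Fin (n + 1) → ℕ) :=
  open Classical in
  (Fintype.piFinset fun _ => Finset.Icc k A).filter
    fun j => Antitone j ∧ j 0 = A ∧ j (Fin.last n) = k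

/-- The weight `Ξ_L^0(i, k)` with `L = n + 1`, as a nested sum over the chains
`a_i = j₀ ≥ j₁ ≥ ⋯ ≥ j_{L-1} = k`. The index `i.succAbove s` runs over the indices other than `i`
in increasing order, i.e. it is `s + U(s - i)` with the Heaviside step `U`, `U(0) = 1`. -/
def Xi0 {n : ℕ} (a : Fin (n + 1) → ℕ) (b : Fin (n + 1) → ℝ) (i : Fin (n + 1)) (k : ℕ) : ℝ :=
  ∑ j ∈ chains n (a i) k,
    (-1 : ℝ) ^ ((∑ q, a q) - a i) * ((∏ w, b w ^ a w) / b i ^ k) *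
      ∏ s : Fin n,
        (((j s.castSucc + a (i.succAbove s) - j s.succ - 1)! : ℕ) : ℝ) /
            ((((a (i.succAbove s) - 1)! : ℕ) : ℝ) * (((j s.castSucc - j s.succ)! : ℕ) : ℝ)) *
          (b i - b (i.succAbove s)) ^
            ((j s.succ : ℤ) - (j s.castSucc : ℤ) - (a (i.succAbove s) : ℤ))

end

/-!
The characteristic function of the Pearson type III distribution with parameters `(a, b, m)` is
`t ↦ exp (itm) * (b / (b - it)) ^ a`. It is obtained from the moment generating function of the
gamma distribution by analytic continuation and an affine change of variables. Equal scales
therefore add up their shapes, while for distinct scales `∏ i, (b i / (b i - it)) ^ a i` splits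
into partial fractions.

The coefficients at the pole `b i` are the Taylor coefficients there of the product of the other
factors `(· - b q) ^ (-a q)`. Each of these factors has a binomial Taylor series, and multiplying
the series one at a time gives the sum over chains, a chain recording the degree that remains after
each factor. Comparing coefficients in the logarithmic derivative of that product gives the
recursion.

The weights may be negative, so the resulting mixture is at first only the density of a signed
measure. By uniqueness of the characteristic function it is the density of the sum, hence
nonnegative almost everywhere. It is nonnegative everywhere because it is continuous off the common
shift and vanishes there.
-/

section Chains

theorem mem_chains {n A k : ℕ} {j : Fin (n + 1) → ℕ} :
    j ∈ chains n A k ↔ Antitone j ∧ j 0 = A ∧ j (Fin.last n) = k := by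
  rw [chains, Finset.mem_filter, Fintype.mem_piFinset, and_iff_right_iff_imp]
  rintro ⟨hj, rfl, rfl⟩ s
  exact Finset.mem_Icc.2 ⟨hj s.le_last, hj s.zero_le⟩

theorem chains_zero_self (k : ℕ) : chains 0 k k = {fun _ => k} := by
  ext j
  rw [mem_chains, Finset.mem_singleton]
  constructor
  · rintro ⟨-, h, -⟩
    ext s
    rw [Fin.fin_one_eq_zero s, h]
  · rintro rfl
    exact ⟨antitone_const, rfl, rfl⟩

theorem chains_zero_of_ne {A k : ℕ} (h : A ≠ k) : chains 0 A k = ∅ := by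
  refine Finset.eq_empty_of_forall_notMem fun j hj => h ?_
  obtain ⟨-, hA, hk⟩ := mem_chains.1 hj
  exact hA.symm.trans hk

theorem cons_mem_chains {n A B k : ℕ} {j : Fin (n + 1) → ℕ} (hj : j ∈ chains n B k)
    (hBA : B ≤ A) : Fin.cons A j ∈ chains (n + 1) A k := by
  obtain ⟨hanti, rfl, rfl⟩ := mem_chains.1 hj
  refine mem_chains.2 ⟨?_, rfl, rfl⟩
  refine Fin.antitone_iff_succ_le.2 fun s => ?_
  cases s using Fin.cases with
  | zero => exact hBA
  | succ s => exact hanti s.castSucc_le_succ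

theorem tail_mem_chains {n A k : ℕ} {j : Fin (n + 2) → ℕ} (hj : j ∈ chains (n + 1) A k) :
    Fin.tail j ∈ chains n (j 1) k := by
  obtain ⟨hanti, rfl, rfl⟩ := mem_chains.1 hj
  exact mem_chains.2 ⟨fun s t hst => hanti (Fin.succ_le_succ_iff.2 hst), rfl, rfl⟩

theorem sum_chains_succ {M : Type*} [AddCommMonoid M] (n A k : ℕ) (F : (Fin (n + 2) → ℕ) → M) :
    ∑ j ∈ chains (n + 1) A k, F j =
      ∑ B ∈ Finset.Icc k A, ∑ j ∈ chains n B k, F (Fin.cons A j) := by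
  rw [Finset.sum_sigma']
  refine Finset.sum_bij' (fun j _ => ⟨j 1, Fin.tail j⟩) (fun p _ => Fin.cons A p.2) ?_ ?_ ?_ ?_ ?_
  · intro j hj
    obtain ⟨hanti, hA, hk⟩ := mem_chains.1 hj
    refine Finset.mem_sigma.2 ⟨Finset.mem_Icc.2 ⟨?_, ?_⟩, tail_mem_chains hj⟩
    · exact hk.symm.le.trans (hanti (Fin.le_last 1))
    · exact (hanti (Fin.zero_le 1)).trans hA.le
  · rintro ⟨B, j⟩ hp
    obtain ⟨hB, hj⟩ := Finset.mem_sigma.1 hp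
    exact cons_mem_chains hj (Finset.mem_Icc.1 hB).2
  · intro j hj
    obtain ⟨-, rfl, -⟩ := mem_chains.1 hj
    exact Fin.cons_self_tail j
  · rintro ⟨B, j⟩ hp
    obtain ⟨-, hB, -⟩ := mem_chains.1 (Finset.mem_sigma.1 hp).2
    exact Sigma.ext hB HEq.rfl
  · intro j hj
    obtain ⟨-, rfl, -⟩ := mem_chains.1 hj
    exact congrArg F (Fin.cons_self_tail j).symm

theorem sum_Icc_eq_sum_antidiagonal {M : Type*} [AddCommMonoid M] {k A : ℕ} (hk : k ≤ A)
    (F : ℕ → ℕ → M) :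
    ∑ B ∈ Finset.Icc k A, F (A - B) (B - k) =
      ∑ p ∈ Finset.HasAntidiagonal.antidiagonal (A - k), F p.1 p.2 := by
  refine Finset.sum_bij' (fun B _ => (A - B, B - k)) (fun p _ => k + p.2) ?_ ?_ ?_ ?_ ?_ <;>
    simp only [Finset.mem_Icc, Finset.HasAntidiagonal.mem_antidiagonal, Prod.forall,
      Prod.mk.injEq] <;>
    grind

theorem sum_chains_prod_coeff {R : Type*} [CommSemiring R] {n A k : ℕ} (hk : k ≤ A)
    (f : Fin n → PowerSeries R) :
    ∑ j ∈ chains n A k, ∏ s, PowerSeries.coeff (j s.castSucc - j s.succ) (f s) =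
      PowerSeries.coeff (A - k) (∏ s, f s) := by
  induction n generalizing A with
  | zero =>
    rcases hk.eq_or_lt with rfl | hlt
    · simp [chains_zero_self]
    · simp [chains_zero_of_ne hlt.ne', PowerSeries.coeff_one, (Nat.sub_pos_of_lt hlt).ne']
  | succ n ih =>
    rw [sum_chains_succ, Fin.prod_univ_succ, PowerSeries.coeff_mul,
      ← sum_Icc_eq_sum_antidiagonal hk fun p q =>
        PowerSeries.coeff p (f 0) * PowerSeries.coeff q (∏ s : Fin n, f s.succ)]
    refine Finset.sum_congr rfl fun B hB => ?_
    rw [← ih (Finset.mem_Icc.1 hB).1, Finset.mul_sum]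
    refine Finset.sum_congr rfl fun j hj => ?_
    rw [Fin.prod_univ_succ, ← (mem_chains.1 hj).2.1]
    rfl

end Chains

section InvXSubC

open PowerSeries

variable {K : Type*} [Field K]

theorem inv_X_sub_C_eq_C_mul_rescale (c : K) :
    (X - C c)⁻¹ = C (-c⁻¹) * rescale c⁻¹ (mk 1) := by
  rcases eq_or_ne c 0 with rfl | hc
  · simp
  · have hX : X - C c = C (-c) * rescale c⁻¹ (1 - X) := by
      simp [rescale_X, mul_sub, ← mul_assoc, ← map_mul, hc, neg_add_eq_sub]
    rw [PowerSeries.inv_eq_iff_mul_eq_one (by simpa using hc), hX, mul_mul_mul_comm, ← map_mul,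
      ← map_mul, mk_one_mul_one_sub_eq_one, map_one, mul_one, neg_mul_neg, inv_mul_cancel₀ hc,
      map_one]

theorem coeff_inv_X_sub_C (c : K) (r : ℕ) : coeff r (X - C c)⁻¹ = -c⁻¹ ^ (r + 1) := by
  simp [inv_X_sub_C_eq_C_mul_rescale, coeff_rescale, pow_succ']

theorem coeff_inv_X_sub_C_pow [CharZero K] (c : K) {a : ℕ} (ha : 0 < a) (r : ℕ) :
    coeff r ((X - C c)⁻¹ ^ a) =
      (-1) ^ a * ((((r + a - 1)! : ℕ) : K) / (((a - 1)! : ℕ) * (r ! : ℕ)) * c⁻¹ ^ (r + a)) := by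
  obtain ⟨d, rfl⟩ := Nat.exists_eq_succ_of_ne_zero ha.ne'
  rw [Nat.succ_eq_add_one, inv_X_sub_C_eq_C_mul_rescale, mul_pow, ← map_pow, ← map_pow,
    coeff_C_mul, coeff_rescale, mk_one_pow_eq_mk_choose_add, coeff_mk,
    Nat.cast_choose K (Nat.le_add_right d r), neg_pow, Nat.add_sub_cancel_left,
    Nat.add_sub_cancel, show r + (d + 1) - 1 = d + r by omega]
  ring

theorem derivative_inv_X_sub_C_pow (c : K) (a : ℕ) :
    d⁄dX K ((X - C c)⁻¹ ^ a) = -(C (a : K) * (X - C c)⁻¹ * (X - C c)⁻¹ ^ a) := by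
  have hinv : d⁄dX K (X - C c)⁻¹ = -(X - C c)⁻¹ ^ 2 := by
    rw [PowerSeries.derivative_inv', map_sub, derivative_X, derivative_C, sub_zero, mul_one]
  rw [PowerSeries.derivative_pow, hinv, map_natCast]
  cases a with
  | zero => simp
  | succ d =>
    rw [Nat.add_sub_cancel]
    ring

theorem derivative_prod_inv_X_sub_C_pow {ι : Type*} (s : Finset ι) (a : ι → ℕ) (c : ι → K) :
    d⁄dX K (∏ q ∈ s, (X - C (c q))⁻¹ ^ a q) =
      -((∑ q ∈ s, C (a q : K) * (X - C (c q))⁻¹) * ∏ q ∈ s, (X - C (c q))⁻¹ ^ a q) := by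
  classical
  induction s using Finset.induction_on with
  | empty => simp
  | insert q s hq ih =>
    rw [Finset.prod_insert hq, Finset.sum_insert hq, Derivation.leibniz,
      derivative_inv_X_sub_C_pow, ih, smul_eq_mul, smul_eq_mul]
    ring

theorem natCast_mul_coeff_prod_inv_X_sub_C_pow {ι : Type*} (s : Finset ι) (a : ι → ℕ) (c : ι → K)
    (r : ℕ) :
    (r : K) * coeff r (∏ q ∈ s, (X - C (c q))⁻¹ ^ a q) =
      ∑ j ∈ Finset.Icc 1 r, ∑ q ∈ s, (a q : K) * (c q)⁻¹ ^ j *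
        coeff (r - j) (∏ q ∈ s, (X - C (c q))⁻¹ ^ a q) := by
  cases r with
  | zero => simp
  | succ r =>
    rw [Nat.cast_succ, mul_comm, ← coeff_derivative, derivative_prod_inv_X_sub_C_pow, ← neg_mul,
      coeff_mul, Finset.Nat.sum_antidiagonal_eq_sum_range_succ_mk, ← Finset.Ico_succ_right_eq_Icc,
      Order.succ_eq_add_one, Finset.sum_Ico_eq_sum_range, Nat.add_sub_cancel]
    refine Finset.sum_congr rfl fun j _ => ?_
    rw [← Finset.sum_mul, add_comm 1 j, Nat.add_sub_add_right]
    simp only [map_neg, map_sum, coeff_C_mul, coeff_inv_X_sub_C, mul_neg, Finset.sum_neg_distrib,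
      neg_neg]

end InvXSubC

section PartialFractions

theorem X_pow_dvd_one_sub_trunc_mul {R : Type*} [CommRing R] {f : PowerSeries R}
    {p : Polynomial R} (h : f * p = 1) (N : ℕ) :
    (Polynomial.X : Polynomial R) ^ N ∣ 1 - PowerSeries.trunc N f * p := by
  refine Polynomial.X_pow_dvd_iff.2 fun d hd => ?_
  have htrunc := congrArg (Polynomial.coeff · d) (PowerSeries.trunc_trunc_mul (n := N) f p)
  simp only [PowerSeries.coeff_trunc, hd, if_true, h] at htrunc
  rw [Polynomial.coeff_sub, sub_eq_zero, ← Polynomial.coeff_coe, ← Polynomial.coeff_coe,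
    Polynomial.coe_mul, htrunc, Polynomial.coe_one]

variable {K ι : Type*} [Field K] [Fintype ι] [DecidableEq ι]

theorem sum_mul_prod_erase_eq_one {p r : ι → Polynomial K} (hpos : ∃ i, 0 < (p i).degree)
    (hcop : Pairwise (Function.onFun IsCoprime p)) (hdeg : ∀ i, (r i).degree < (p i).degree)
    (hdvd : ∀ i, p i ∣ 1 - r i * ∏ j ∈ Finset.univ.erase i, p j) :
    ∑ i, r i * ∏ j ∈ Finset.univ.erase i, p j = 1 := by
  have hp : ∀ i, p i ≠ 0 := fun i => Polynomial.degree_ne_bot.1 (bot_le.trans_lt (hdeg i)).ne'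
  have hlt : ∀ i, (r i * ∏ j ∈ Finset.univ.erase i, p j).degree < (∏ j, p j).degree := fun i => by
    rw [← Finset.mul_prod_erase _ p (Finset.mem_univ i), Polynomial.degree_mul,
      Polynomial.degree_mul]
    refine WithBot.add_lt_add_right (Polynomial.degree_ne_bot.2 ?_) (hdeg i)
    exact Finset.prod_ne_zero_iff.2 fun j _ => hp j
  refine (sub_eq_zero.1 (Polynomial.eq_zero_of_dvd_of_degree_lt (p := ∏ j, p j) ?_ ?_)).symm
  · refine Finset.prod_dvd_of_coprime (fun i _ j _ hij => hcop hij) fun i _ => ?_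
    rw [← Finset.add_sum_erase _ _ (Finset.mem_univ i), ← sub_sub]
    refine dvd_sub (hdvd i) (Finset.dvd_sum fun j hj => ?_)
    refine Dvd.dvd.mul_left (Finset.dvd_prod_of_mem p (Finset.mem_erase.2 ⟨?_, ?_⟩)) _
    exacts [(Finset.ne_of_mem_erase hj).symm, Finset.mem_univ i]
  · obtain ⟨i, hi⟩ := hpos
    have hone : (1 : Polynomial K).degree < (∏ j, p j).degree := by
      rw [Polynomial.degree_one]
      exact hi.trans_le (Polynomial.degree_le_of_dvd (Finset.dvd_prod_of_mem p (Finset.mem_univ i))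
        (Finset.prod_ne_zero_iff.2 fun j _ => hp j))
    refine (Polynomial.degree_sub_le _ _).trans_lt (max_lt hone ?_)
    exact (Polynomial.degree_sum_le _ _).trans_lt
      ((Finset.sup_lt_iff (bot_le.trans_lt hone)).2 fun i _ => hlt i)

/-- The Taylor expansion of `∏ q ≠ i, (x + b q) ^ (-a q)` at `x = -b i`, in the local parameter
`x + b i`. Its coefficients are the numerators of the partial fractions at this pole. -/
noncomputable def cofactorSeries (a : ι → ℕ) (b : ι → K) (i : ι) : PowerSeries K :=
  ∏ q ∈ Finset.univ.erase i, (PowerSeries.X - PowerSeries.C (b i - b q))⁻¹ ^ a q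

theorem cofactorSeries_mul_prod (a : ι → ℕ) {b : ι → K} (hb : Function.Injective b) (i : ι) :
    cofactorSeries a b i * ((∏ q ∈ Finset.univ.erase i,
      (Polynomial.X - Polynomial.C (b i - b q)) ^ a q : Polynomial K) : PowerSeries K) = 1 := by
  rw [← Polynomial.coeToPowerSeries.ringHom_apply, map_prod, cofactorSeries,
    ← Finset.prod_mul_distrib]
  refine Finset.prod_eq_one fun q hq => ?_
  have hne : b i - b q ≠ 0 := sub_ne_zero.2 (hb.ne (Finset.ne_of_mem_erase hq).symm)
  rw [Polynomial.coeToPowerSeries.ringHom_apply, Polynomial.coe_pow, Polynomial.coe_sub,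
    Polynomial.coe_X, Polynomial.coe_C, ← mul_pow,
    PowerSeries.inv_mul_cancel _ (by simpa [sub_eq_zero, eq_comm] using hne), one_pow]

theorem sum_taylor_trunc_cofactorSeries_mul_prod {a : ι → ℕ} (ha : ∃ i, 0 < a i) {b : ι → K}
    (hb : Function.Injective b) :
    ∑ i, Polynomial.taylor (b i) (PowerSeries.trunc (a i) (cofactorSeries a b i)) *
      ∏ q ∈ Finset.univ.erase i, (Polynomial.X + Polynomial.C (b q)) ^ a q = 1 := by
  refine sum_mul_prod_erase_eq_one (p := fun i => (Polynomial.X + Polynomial.C (b i)) ^ a i)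
    ?_ (fun i j hij => ?_) (fun i => ?_) fun i => ?_
  · obtain ⟨i, hi⟩ := ha
    refine ⟨i, ?_⟩
    rw [Polynomial.degree_pow, Polynomial.degree_X_add_C, nsmul_one]
    exact_mod_cast hi
  · have h := Polynomial.isCoprime_X_sub_C_of_isUnit_sub (a := -b i) (b := -b j)
      (isUnit_iff_ne_zero.2 (sub_ne_zero.2 (neg_injective.ne (hb.ne hij))))
    simp only [map_neg, sub_neg_eq_add] at h
    exact h.pow
  · rw [Polynomial.degree_taylor, Polynomial.degree_pow, Polynomial.degree_X_add_C, nsmul_one]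
    exact PowerSeries.degree_trunc_lt _ _
  · have h := map_dvd (Polynomial.taylorAlgHom (b i))
      (X_pow_dvd_one_sub_trunc_mul (cofactorSeries_mul_prod a hb i) (a i))
    have hX : Polynomial.taylorAlgHom (b i) Polynomial.X = Polynomial.X + Polynomial.C (b i) :=
      Polynomial.taylor_X _
    have hfactor : ∀ q, Polynomial.taylorAlgHom (b i) (Polynomial.X - Polynomial.C (b i - b q)) =
        Polynomial.X + Polynomial.C (b q) := fun q => by
      rw [map_sub, hX, Polynomial.taylorAlgHom_apply, Polynomial.taylor_C, map_sub]
      ring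
    rw [map_sub, map_mul, map_one, map_prod] at h
    simp only [map_pow, hfactor, hX] at h
    exact h

theorem prod_inv_pow_eq_sum_cofactorSeries {F : Type*} [Field F] [Algebra K F]
    {a : ι → ℕ} (ha : ∃ i, 0 < a i) {b : ι → K} (hb : Function.Injective b) {x : F}
    (hx : ∀ i, x + algebraMap K F (b i) ≠ 0) :
    ∏ w, ((x + algebraMap K F (b w)) ^ a w)⁻¹ =
      ∑ i, ∑ k ∈ Finset.Icc 1 (a i), algebraMap K F
        (PowerSeries.coeff (a i - k) (cofactorSeries a b i)) *
          ((x + algebraMap K F (b i)) ^ k)⁻¹ := by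
  have h := congrArg (Polynomial.aeval x) (sum_taylor_trunc_cofactorSeries_mul_prod ha hb)
  simp only [map_sum, map_mul, map_prod, map_pow, map_add, map_one, Polynomial.taylor_apply,
    Polynomial.aeval_comp, Polynomial.aeval_X, Polynomial.aeval_C] at h
  rw [← mul_one (∏ w, _), ← h, Finset.mul_sum]
  refine Finset.sum_congr rfl fun i _ => ?_
  have hne : ∏ q ∈ Finset.univ.erase i, (x + algebraMap K F (b q)) ^ a q ≠ 0 :=
    Finset.prod_ne_zero_iff.2 fun q _ => pow_ne_zero _ (hx q)
  rw [← Finset.mul_prod_erase _ _ (Finset.mem_univ i), Polynomial.aeval_def,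
    PowerSeries.eval₂_trunc_eq_sum_range, Finset.prod_inv_distrib, mul_comm (Finset.sum _ _),
    mul_assoc, inv_mul_cancel_left₀ hne, Finset.mul_sum]
  refine Finset.sum_bij' (fun r _ => a i - r) (fun k _ => a i - k) ?_ ?_ ?_ ?_ fun r hr => ?_
  iterate 4 grind
  have hr := (Finset.mem_range.1 hr).le
  rw [Nat.sub_sub_self hr, mul_left_comm, pow_sub₀ _ (hx i) hr, mul_inv, inv_inv]

end PartialFractions

section Weights

variable {n : ℕ} {a : Fin (n + 1) → ℕ} {b : Fin (n + 1) → ℝ}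

theorem prod_succAbove_eq_prod_erase {M : Type*} [CommMonoid M] (i : Fin (n + 1))
    (f : Fin (n + 1) → M) : ∏ s : Fin n, f (i.succAbove s) = ∏ q ∈ Finset.univ.erase i, f q := by
  rw [← Finset.compl_singleton, ← Fin.image_succAbove_univ,
    Finset.prod_image fun _ _ _ _ h => Fin.succAbove_right_injective h]

theorem Xi0_eq_coeff_cofactorSeries (ha : ∀ i, 0 < a i) (i : Fin (n + 1)) {k : ℕ}
    (hk : k ≤ a i) :
    Xi0 a b i k = (∏ w, b w ^ a w) / b i ^ k *
      PowerSeries.coeff (a i - k) (cofactorSeries a b i) := by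
  have hsign : (-1 : ℝ) ^ ((∑ q, a q) - a i) = ∏ s : Fin n, (-1 : ℝ) ^ a (i.succAbove s) := by
    rw [Fin.sum_univ_succAbove a i, Nat.add_sub_cancel_left, Finset.prod_pow_eq_pow_sum]
  rw [cofactorSeries, ← prod_succAbove_eq_prod_erase i, ← sum_chains_prod_coeff hk,
    Finset.mul_sum, Xi0]
  refine Finset.sum_congr rfl fun j hj => ?_
  rw [hsign, mul_comm (Finset.prod _ _) (_ / _), mul_assoc, ← Finset.prod_mul_distrib]
  congr 1
  refine Finset.prod_congr rfl fun s _ => ?_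
  have hjs : j s.succ ≤ j s.castSucc := (mem_chains.1 hj).1 s.castSucc_le_succ
  have hexp : (j s.succ : ℤ) - j s.castSucc - a (i.succAbove s) =
      -((j s.castSucc - j s.succ + a (i.succAbove s) : ℕ) : ℤ) := by
    omega
  rw [coeff_inv_X_sub_C_pow _ (ha _), ← Nat.sub_add_comm hjs, inv_pow, hexp, zpow_neg,
    zpow_natCast, Nat.sub_add_comm hjs]

theorem Xi0_self (ha : ∀ i, 0 < a i) (i : Fin (n + 1)) :
    Xi0 a b i (a i) = (∏ w, b w ^ a w) / b i ^ a i *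
      ∏ j ∈ Finset.univ.erase i, (b j - b i) ^ (-(a j : ℤ)) := by
  rw [Xi0_eq_coeff_cofactorSeries ha i le_rfl, Nat.sub_self,
    PowerSeries.coeff_zero_eq_constantCoeff_apply, cofactorSeries, map_prod]
  congr 1
  refine Finset.prod_congr rfl fun q _ => ?_
  rw [map_pow, PowerSeries.constantCoeff_inv, map_sub, PowerSeries.constantCoeff_X,
    PowerSeries.constantCoeff_C, zero_sub, neg_sub, inv_pow, zpow_neg, zpow_natCast]

theorem Xi0_recursion (ha : ∀ i, 0 < a i) {i : Fin (n + 1)} (hb : b i ≠ 0) {k : ℕ}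
    (hk0 : k ≠ 0) (hk : k ≤ a i) :
    Xi0 a b i (a i - k) = 1 / (k : ℝ) * ∑ j ∈ Finset.Icc 1 k, ∑ q ∈ Finset.univ.erase i,
      (a q : ℝ) * b i ^ j * (b i - b q) ^ (-(j : ℤ)) * Xi0 a b i (a i - k + j) := by
  have hrec := natCast_mul_coeff_prod_inv_X_sub_C_pow (Finset.univ.erase i) a (b i - b ·) k
  rw [← cofactorSeries] at hrec
  rw [one_div, eq_inv_mul_iff_mul_eq₀ (Nat.cast_ne_zero.2 hk0),
    Xi0_eq_coeff_cofactorSeries ha i (Nat.sub_le _ _), Nat.sub_sub_self hk, mul_left_comm, hrec,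
    Finset.mul_sum]
  refine Finset.sum_congr rfl fun j hj => ?_
  rw [Finset.mem_Icc] at hj
  rw [Finset.mul_sum]
  refine Finset.sum_congr rfl fun q _ => ?_
  rw [Xi0_eq_coeff_cofactorSeries ha i (by omega), show a i - (a i - k + j) = k - j by omega,
    zpow_neg, zpow_natCast, inv_pow, pow_add]
  have := pow_ne_zero j hb
  field_simp

theorem prod_div_pow_eq_sum_Xi0 {F : Type*} [Field F] [Algebra ℝ F] (ha : ∀ i, 0 < a i)
    (hb0 : ∀ i, b i ≠ 0) (hb : Function.Injective b) {x : F}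
    (hx : ∀ i, x + algebraMap ℝ F (b i) ≠ 0) :
    ∏ i, (algebraMap ℝ F (b i) / (x + algebraMap ℝ F (b i))) ^ a i =
      ∑ i, ∑ k ∈ Finset.Icc 1 (a i),
        algebraMap ℝ F (Xi0 a b i k) * (algebraMap ℝ F (b i) / (x + algebraMap ℝ F (b i))) ^ k := by
  simp_rw [div_eq_mul_inv, mul_pow, inv_pow]
  rw [Finset.prod_mul_distrib, prod_inv_pow_eq_sum_cofactorSeries ⟨0, ha 0⟩ hb hx, Finset.mul_sum]
  refine Finset.sum_congr rfl fun i _ => ?_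
  rw [Finset.mul_sum]
  refine Finset.sum_congr rfl fun k hk => ?_
  rw [Xi0_eq_coeff_cofactorSeries ha i (Finset.mem_Icc.1 hk).2]
  simp only [map_mul, map_div₀, map_prod, map_pow]
  have hbk : algebraMap ℝ F (b i) ^ k ≠ 0 := pow_ne_zero k (by simpa using hb0 i)
  field_simp

end Weights

section Gamma

variable {a r : ℝ}

theorem withDensity_ofReal_gammaPDFReal (a r : ℝ) :
    (volume.withDensity fun x => ENNReal.ofReal (gammaPDFReal a r x)) = gammaMeasure a r :=
  rfl

theorem integrable_gammaPDFReal (ha : 0 < a) (hr : 0 < r) : Integrable (gammaPDFReal a r) := by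
  refine ⟨(measurable_gammaPDFReal a r).aestronglyMeasurable, ?_⟩
  rw [hasFiniteIntegral_iff_ofReal (ae_of_all _ (gammaPDFReal_nonneg ha hr))]
  exact (lintegral_gammaPDF_eq_one ha hr).trans_lt ENNReal.one_lt_top

theorem integral_gammaPDFReal (ha : 0 < a) (hr : 0 < r) : ∫ x, gammaPDFReal a r x = 1 := by
  rw [integral_eq_lintegral_of_nonneg_ae (ae_of_all _ (gammaPDFReal_nonneg ha hr))
    (measurable_gammaPDFReal a r).aestronglyMeasurable]
  exact (congrArg ENNReal.toReal (lintegral_gammaPDF_eq_one ha hr)).trans ENNReal.toReal_one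

theorem gammaPDFReal_mul_exp (hr : 0 < r) {t : ℝ} (ht : t < r) (a x : ℝ) :
    gammaPDFReal a r x * Real.exp (t * x) = (r / (r - t)) ^ a * gammaPDFReal a (r - t) x := by
  have hrt : 0 < r - t := sub_pos.2 ht
  have hexp : Real.exp (-((r - t) * x)) = Real.exp (-(r * x)) * Real.exp (t * x) := by
    rw [← Real.exp_add]
    ring_nf
  rw [gammaPDFReal, gammaPDFReal, hexp, Real.div_rpow hr.le hrt.le]
  split_ifs
  · have := (Real.rpow_pos_of_pos hrt a).ne'
    field_simp
  · ring

theorem integrable_exp_mul_gammaMeasure (ha : 0 < a) (hr : 0 < r) {t : ℝ} (ht : t < r) :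
    Integrable (fun x => Real.exp (t * x)) (gammaMeasure a r) := by
  rw [← withDensity_ofReal_gammaPDFReal, integrable_withDensity_iff_integrable_smul'
    (measurable_gammaPDFReal a r).ennreal_ofReal (ae_of_all _ fun _ => ENNReal.ofReal_lt_top)]
  simp only [ENNReal.toReal_ofReal (gammaPDFReal_nonneg ha hr _), smul_eq_mul,
    gammaPDFReal_mul_exp hr ht]
  exact (integrable_gammaPDFReal ha (sub_pos.2 ht)).const_mul _

theorem mgf_id_gammaMeasure (ha : 0 < a) (hr : 0 < r) {t : ℝ} (ht : t < r) :
    mgf id (gammaMeasure a r) t = (r / (r - t)) ^ a := by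
  rw [mgf, ← withDensity_ofReal_gammaPDFReal, integral_withDensity_eq_integral_toReal_smul
    (measurable_gammaPDFReal a r).ennreal_ofReal (ae_of_all _ fun _ => ENNReal.ofReal_lt_top)]
  simp only [ENNReal.toReal_ofReal (gammaPDFReal_nonneg ha hr _), smul_eq_mul, id_eq,
    gammaPDFReal_mul_exp hr ht]
  rw [integral_const_mul, integral_gammaPDFReal ha (sub_pos.2 ht), mul_one]

theorem ofReal_sub_ne_zero_of_re_ne {z : ℂ} (hz : z.re ≠ r) : (r : ℂ) - z ≠ 0 :=
  fun h => hz (congrArg Complex.re (sub_eq_zero.1 h)).symm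

theorem div_sub_mem_slitPlane (hr : 0 < r) {z : ℂ} (hz : z.re < r) :
    (r : ℂ) / (r - z) ∈ Complex.slitPlane := by
  have hre : 0 < ((r : ℂ) - z).re := by simpa using hz
  refine Or.inl ?_
  rw [div_eq_mul_inv, Complex.re_ofReal_mul, Complex.inv_re]
  exact mul_pos hr (div_pos hre (Complex.normSq_pos.2 (ofReal_sub_ne_zero_of_re_ne hz.ne)))

theorem complexMGF_id_gammaMeasure (ha : 0 < a) (hr : 0 < r) {z : ℂ} (hz : z.re < r) :
    complexMGF id (gammaMeasure a r) z = (r / (r - z)) ^ (a : ℂ) := by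
  have hsub : Set.Iio r ⊆ interior (integrableExpSet id (gammaMeasure a r)) :=
    isOpen_Iio.subset_interior_iff.2 fun t ht => integrable_exp_mul_gammaMeasure ha hr ht
  have hmgf : AnalyticOnNhd ℂ (complexMGF id (gammaMeasure a r)) {z | z.re < r} :=
    analyticOnNhd_complexMGF.mono fun z hz => hsub hz
  have hcpow : AnalyticOnNhd ℂ (fun z : ℂ => ((r : ℂ) / (r - z)) ^ (a : ℂ)) {z | z.re < r} :=
    fun z hz => (analyticAt_const.div (analyticAt_const.sub analyticAt_id)
      (ofReal_sub_ne_zero_of_re_ne (ne_of_lt hz))).cpow analyticAt_const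
        (div_sub_mem_slitPlane hr hz)
  refine hmgf.eqOn_of_preconnected_of_frequently_eq hcpow
    (convex_halfSpace_re_lt r).isPreconnected (z₀ := 0) (by simpa using hr) ?_ hz
  have hreal : ∀ᶠ t : ℝ in nhdsWithin 0 {0}ᶜ,
      complexMGF id (gammaMeasure a r) t = ((r : ℂ) / (r - t)) ^ (a : ℂ) := by
    filter_upwards [nhdsWithin_le_nhds (Iio_mem_nhds hr)] with t ht
    rw [complexMGF_ofReal, mgf_id_gammaMeasure ha hr ht,
      Complex.ofReal_cpow (div_pos hr (sub_pos.2 ht)).le, Complex.ofReal_div, Complex.ofReal_sub]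
  have htendsto : Filter.Tendsto ((↑) : ℝ → ℂ) (nhdsWithin 0 {0}ᶜ) (nhdsWithin 0 {0}ᶜ) :=
    Complex.continuous_ofReal.continuousWithinAt.tendsto_nhdsWithin
      fun t ht => Complex.ofReal_ne_zero.2 ht
  exact htendsto.frequently hreal.frequently

theorem charFun_gammaMeasure (ha : 0 < a) (hr : 0 < r) (t : ℝ) :
    charFun (gammaMeasure a r) t = (r / (r - t * Complex.I)) ^ (a : ℂ) := by
  rw [← complexMGF_id_mul_I, complexMGF_id_gammaMeasure ha hr (by simpa using hr)]

end Gamma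

section DensityCharFun

open scoped RealInnerProductSpace

variable {E : Type*} [NormedAddCommGroup E] [InnerProductSpace ℝ E] [MeasurableSpace E]
  {ν : Measure E} {f g : E → ℝ}

/-- The characteristic function of the signed measure with density `g` with respect to `ν`. It
extends `charFun` to mixture densities not yet known to be nonnegative. -/
noncomputable def densityCharFun (ν : Measure E) (g : E → ℝ) (t : E) : ℂ :=
  ∫ x, Complex.exp (⟪x, t⟫ * Complex.I) * g x ∂ν

theorem densityCharFun_apply_real (ν : Measure ℝ) (g : ℝ → ℝ) (t : ℝ) :
    densityCharFun ν g t = ∫ x, Complex.exp (t * x * Complex.I) * g x ∂ν := by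
  simp [densityCharFun]

theorem densityCharFun_congr_ae (h : f =ᵐ[ν] g) (t : E) :
    densityCharFun ν f t = densityCharFun ν g t := by
  refine integral_congr_ae ?_
  filter_upwards [h] with x hx
  rw [hx]

theorem densityCharFun_const_mul (c : ℝ) (g : E → ℝ) (t : E) :
    densityCharFun ν (fun x => c * g x) t = c * densityCharFun ν g t := by
  rw [densityCharFun, densityCharFun, ← integral_const_mul]
  simp_rw [Complex.ofReal_mul, mul_left_comm (c : ℂ)]

theorem integrable_cexp_inner_mul [OpensMeasurableSpace E] [SecondCountableTopology E]
    (hg : Integrable g ν) (t : E) :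
    Integrable (fun x => Complex.exp (⟪x, t⟫ * Complex.I) * g x) ν :=
  hg.ofReal.bdd_mul (Continuous.aestronglyMeasurable (by fun_prop))
    (ae_of_all _ fun x => (Complex.norm_exp_ofReal_mul_I _).le)

theorem densityCharFun_add [OpensMeasurableSpace E] [SecondCountableTopology E]
    (hf : Integrable f ν) (hg : Integrable g ν) (t : E) :
    densityCharFun ν (f + g) t = densityCharFun ν f t + densityCharFun ν g t := by
  rw [densityCharFun, densityCharFun, densityCharFun,
    ← integral_add (integrable_cexp_inner_mul hf t) (integrable_cexp_inner_mul hg t)]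
  simp_rw [Pi.add_apply, Complex.ofReal_add, mul_add]

theorem densityCharFun_sum [OpensMeasurableSpace E] [SecondCountableTopology E]
    {κ : Type*} {s : Finset κ} {f : κ → E → ℝ} (hf : ∀ i ∈ s, Integrable (f i) ν) (t : E) :
    densityCharFun ν (fun x => ∑ i ∈ s, f i x) t = ∑ i ∈ s, densityCharFun ν (f i) t := by
  simp_rw [densityCharFun, Complex.ofReal_sum, Finset.mul_sum]
  exact integral_finsetSum s fun i hi => integrable_cexp_inner_mul (hf i hi) t

theorem charFun_withDensity_ofReal [OpensMeasurableSpace E] (hg : Measurable g) (t : E) :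
    charFun (ν.withDensity fun x => ENNReal.ofReal (g x)) t =
      densityCharFun ν (fun x => max (g x) 0) t := by
  rw [charFun_apply, integral_withDensity_eq_integral_toReal_smul hg.ennreal_ofReal
    (ae_of_all _ fun _ => ENNReal.ofReal_lt_top)]
  simp_rw [ENNReal.toReal_ofReal', Complex.real_smul, mul_comm (Complex.ofReal (max _ _))]
  rfl

theorem charFun_add_measure [OpensMeasurableSpace E] [SecondCountableTopology E]
    (μ ν : Measure E) [IsFiniteMeasure μ] [IsFiniteMeasure ν] (t : E) :
    charFun (μ + ν) t = charFun μ t + charFun ν t := by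
  simp only [charFun_eq_integral_innerProbChar]
  exact integral_add_measure (BoundedContinuousFunction.integrable _ _)
    (BoundedContinuousFunction.integrable _ _)

theorem add_withDensity_neg_eq_of_charFun_eq [BorelSpace E] [SecondCountableTopology E]
    [CompleteSpace E] {μ : Measure E} [IsFiniteMeasure μ] (hgm : Measurable g)
    (hg : Integrable g ν) (h : charFun μ = densityCharFun ν g) :
    μ + (ν.withDensity fun x => ENNReal.ofReal (-g x)) =
      ν.withDensity fun x => ENNReal.ofReal (g x) := by
  have := isFiniteMeasure_withDensity_ofReal hg.2
  have := isFiniteMeasure_withDensity_ofReal (f := fun x => -g x) hg.neg.2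
  have hparts : (fun x => max (g x) 0) = g + fun x => max (-g x) 0 := by
    ext x
    rw [Pi.add_apply]
    grind
  refine Measure.ext_of_charFun (funext fun t => ?_)
  rw [charFun_add_measure, h, charFun_withDensity_ofReal hgm,
    charFun_withDensity_ofReal hgm.fun_neg, hparts]
  exact (densityCharFun_add hg hg.neg.pos_part t).symm

end DensityCharFun

section Uniqueness

theorem ae_nonneg_of_add_withDensity_neg_eq {α : Type*} [MeasurableSpace α] {μ ν : Measure α}
    {g : α → ℝ} (hg : Measurable g) (h : μ + (ν.withDensity fun x => ENNReal.ofReal (-g x)) =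
      ν.withDensity fun x => ENNReal.ofReal (g x)) : 0 ≤ᵐ[ν] g := by
  have hs : MeasurableSet {x | g x < 0} := measurableSet_lt hg measurable_const
  have hpos : (ν.withDensity fun x => ENNReal.ofReal (g x)) {x | g x < 0} = 0 := by
    rw [withDensity_apply _ hs]
    exact (setLIntegral_congr_fun hs fun x hx => ENNReal.ofReal_of_nonpos (le_of_lt hx)).trans
      lintegral_zero
  rw [← h, Measure.add_apply, add_eq_zero,
    withDensity_apply_eq_zero (by fun_prop)] at hpos
  rw [Filter.EventuallyLE, ae_iff]
  convert hpos.2 using 2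
  ext x
  simp

theorem eq_withDensity_of_add_withDensity_neg_eq {α : Type*} [MeasurableSpace α] {μ ν : Measure α}
    {g : α → ℝ} (hg : 0 ≤ᵐ[ν] g) (h : μ + (ν.withDensity fun x => ENNReal.ofReal (-g x)) =
      ν.withDensity fun x => ENNReal.ofReal (g x)) :
    μ = ν.withDensity fun x => ENNReal.ofReal (g x) := by
  have hneg : (fun x => ENNReal.ofReal (-g x)) =ᵐ[ν] 0 := by
    filter_upwards [hg] with x hx
    exact ENNReal.ofReal_of_nonpos (neg_nonpos.2 hx)
  rw [← h, withDensity_congr_ae hneg, withDensity_zero, add_zero]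

theorem HasRealPDF.charFun_eq {Ω : Type*} [MeasurableSpace Ω] {P : Measure Ω} {X : Ω → ℝ}
    {g : ℝ → ℝ} (h : HasRealPDF X g P) : charFun (P.map X) = densityCharFun volume g := by
  obtain ⟨hgm, hg, hlaw⟩ := h
  ext t
  rw [hlaw.map_eq, charFun_withDensity_ofReal hgm]
  simp_rw [max_eq_left (hg _)]

theorem HasRealPDF.of_charFun_eq {Ω : Type*} [MeasurableSpace Ω] {P : Measure Ω}
    [IsFiniteMeasure P] {X : Ω → ℝ} (hX : AEMeasurable X P) {g : ℝ → ℝ} (hgm : Measurable g)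
    (hg : Integrable g) (hopen : IsOpen {x | g x < 0})
    (h : charFun (P.map X) = densityCharFun volume g) : HasRealPDF X g P := by
  have hadd := add_withDensity_neg_eq_of_charFun_eq hgm hg h
  have hae := ae_nonneg_of_add_withDensity_neg_eq hgm hadd
  refine ⟨hgm, fun x => not_lt.1 fun hx => ?_, hX,
    eq_withDensity_of_add_withDensity_neg_eq hae hadd⟩
  refine hopen.measure_ne_zero volume ⟨x, hx⟩ ?_
  simpa [Filter.EventuallyLE, ae_iff] using hae

theorem isOpen_setOf_lt_of_continuousOn_compl {α β : Type*} [TopologicalSpace α] [T1Space α]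
    [TopologicalSpace β] [LinearOrder β] [OrderTopology β] {g : α → β} {m : α} {c : β}
    (hg : ContinuousOn g {m}ᶜ) (hm : c ≤ g m) : IsOpen {x | g x < c} := by
  convert hg.isOpen_inter_preimage isOpen_compl_singleton (isOpen_Iio (a := c)) using 1
  refine (Set.inter_eq_right.2 fun x hx hxm => ?_).symm
  rw [Set.mem_singleton_iff] at hxm
  exact not_lt.2 hm (hxm ▸ hx)

end Uniqueness

section Pearson

variable {a b : ℝ}

theorem measurable_pearsonPDF (a b m : ℝ) : Measurable (pearsonPDF a b m) :=
  Measurable.ite (measurableSet_lt measurable_const (by fun_prop)) (by fun_prop) measurable_const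

theorem pearsonPDF_self (a b m : ℝ) : pearsonPDF a b m m = 0 := by
  simp [pearsonPDF]

theorem pearsonPDF_eq_abs_mul_comp (a b m : ℝ) :
    pearsonPDF a b m = fun x => |b| * pearsonPDF a 1 0 (b * (x - m)) := by
  ext x
  simp only [pearsonPDF, abs_one, one_mul, sub_zero, mul_ite, mul_zero]
  congr 1
  ring

theorem continuousOn_pearsonPDF (a : ℝ) (hb : b ≠ 0) (m : ℝ) :
    ContinuousOn (pearsonPDF a b m) {m}ᶜ := by
  intro x hx
  have hne : b * (x - m) ≠ 0 := mul_ne_zero hb (sub_ne_zero.2 hx)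
  have hcont : Continuous fun y => b * (y - m) := by fun_prop
  refine ContinuousAt.continuousWithinAt ?_
  rcases hne.lt_or_gt with hneg | hpos
  · refine continuousAt_const.congr (f := fun _ => (0 : ℝ)) ?_
    filter_upwards [hcont.continuousAt.eventually_lt_const hneg] with y hy
    rw [pearsonPDF, if_neg hy.not_gt]
  · refine ContinuousAt.congr (f := fun y =>
      |b| / Real.Gamma a * (b * (y - m)) ^ (a - 1) * Real.exp (-(b * (y - m)))) ?_ ?_
    · exact (continuousAt_const.mul (hcont.continuousAt.rpow_const (Or.inl hne))).mul
        (by fun_prop)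
    · filter_upwards [hcont.continuousAt.eventually_const_lt hpos] with y hy
      rw [pearsonPDF, if_pos hy]

theorem pearsonPDF_one_zero_ae_eq_gammaPDFReal (a : ℝ) :
    pearsonPDF a 1 0 =ᵐ[volume] gammaPDFReal a 1 := by
  filter_upwards [Measure.ae_ne volume 0] with x hx
  simp only [pearsonPDF, gammaPDFReal, abs_one, one_mul, sub_zero, Real.one_rpow,
    hx.symm.le_iff_lt]

theorem integrable_pearsonPDF (ha : 0 < a) (hb : b ≠ 0) (m : ℝ) :
    Integrable (pearsonPDF a b m) := by
  have hstd : Integrable (pearsonPDF a 1 0) :=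
    (integrable_gammaPDFReal ha one_pos).congr (pearsonPDF_one_zero_ae_eq_gammaPDFReal a).symm
  rw [pearsonPDF_eq_abs_mul_comp]
  exact ((hstd.comp_mul_left' hb).comp_sub_right m).const_mul _

theorem densityCharFun_comp_mul_sub (g : ℝ → ℝ) (hb : b ≠ 0) (m t : ℝ) :
    densityCharFun volume (fun x => |b| * g (b * (x - m))) t =
      Complex.exp (t * m * Complex.I) * densityCharFun volume g (t / b) := by
  have hb' : (b : ℂ) ≠ 0 := mod_cast hb
  let F : ℝ → ℂ := fun y => Complex.exp ((t / b : ℝ) * y * Complex.I) * g y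
  have hphase (x : ℝ) : Complex.exp (t * x * Complex.I) * g (b * (x - m)) =
      Complex.exp (t * m * Complex.I) * F (b * (x - m)) := by
    rw [← mul_assoc, ← Complex.exp_add]
    push_cast
    field_simp
    ring_nf
  have hsubst : ∫ x : ℝ, F (b * (x - m)) = |b⁻¹| • ∫ y, F y := by
    rw [integral_sub_right_eq_self fun x => F (b * x), Measure.integral_comp_mul_left]
  have habs : ((|b| : ℝ) : ℂ) ≠ 0 := Complex.ofReal_ne_zero.2 (abs_ne_zero.2 hb)
  rw [densityCharFun_const_mul, densityCharFun_apply_real, densityCharFun_apply_real]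
  simp_rw [hphase]
  rw [integral_const_mul, hsubst, abs_inv, Complex.real_smul, Complex.ofReal_inv, mul_left_comm,
    mul_inv_cancel_left₀ habs]

theorem densityCharFun_pearsonPDF_one_zero (ha : 0 < a) (t : ℝ) :
    densityCharFun volume (pearsonPDF a 1 0) t = (1 / (1 - t * Complex.I)) ^ (a : ℂ) := by
  have hgamma := charFun_gammaMeasure ha one_pos t
  rw [← withDensity_ofReal_gammaPDFReal, charFun_withDensity_ofReal (measurable_gammaPDFReal a 1)]
    at hgamma
  simp_rw [max_eq_left (gammaPDFReal_nonneg ha one_pos _)] at hgamma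
  rw [densityCharFun_congr_ae (pearsonPDF_one_zero_ae_eq_gammaPDFReal a), hgamma,
    Complex.ofReal_one]

theorem densityCharFun_pearsonPDF (ha : 0 < a) (hb : b ≠ 0) (m t : ℝ) :
    densityCharFun volume (pearsonPDF a b m) t =
      Complex.exp (t * m * Complex.I) * (b / (b - t * Complex.I)) ^ (a : ℂ) := by
  have hb' : (b : ℂ) ≠ 0 := mod_cast hb
  have hscale : (1 : ℂ) / (1 - (t / b : ℝ) * Complex.I) = b / (b - t * Complex.I) := by
    push_cast
    rw [← mul_div_mul_left _ _ hb']
    field_simp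
  rw [pearsonPDF_eq_abs_mul_comp, densityCharFun_comp_mul_sub _ hb,
    densityCharFun_pearsonPDF_one_zero ha, hscale]

end Pearson

section Sums

variable {Ω ι : Type*} [MeasurableSpace Ω] {P : Measure Ω}

theorem HasRealPDF.sum_mul_pearsonPDF_of_charFun_eq [IsFiniteMeasure P] {X : Ω → ℝ}
    (hX : AEMeasurable X P) {s : Finset ι} {w a b : ι → ℝ} {m : ℝ} (ha : ∀ p ∈ s, 0 < a p)
    (hb : ∀ p ∈ s, b p ≠ 0)
    (h : ∀ t : ℝ, charFun (P.map X) t = Complex.exp (t * m * Complex.I) *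
      ∑ p ∈ s, w p * (b p / (b p - t * Complex.I)) ^ (a p : ℂ)) :
    HasRealPDF X (fun x => ∑ p ∈ s, w p * pearsonPDF (a p) (b p) m x) P := by
  have hint : ∀ p ∈ s, Integrable fun x => w p * pearsonPDF (a p) (b p) m x :=
    fun p hp => (integrable_pearsonPDF (ha p hp) (hb p hp) m).const_mul _
  refine HasRealPDF.of_charFun_eq hX
    (Finset.measurable_fun_sum _ fun p _ => (measurable_pearsonPDF _ _ _).const_mul _)
    (integrable_finsetSum _ hint) (isOpen_setOf_lt_of_continuousOn_compl (m := m)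
      (continuousOn_finsetSum _ fun p hp =>
        continuousOn_const.mul (continuousOn_pearsonPDF _ (hb p hp) m)) ?_) (funext fun t => ?_)
  · simp only [pearsonPDF_self, mul_zero, Finset.sum_const_zero, le_refl]
  · rw [h, densityCharFun_sum hint, Finset.mul_sum]
    refine Finset.sum_congr rfl fun p hp => ?_
    rw [densityCharFun_const_mul, densityCharFun_pearsonPDF (ha p hp) (hb p hp), mul_left_comm]

variable [Fintype ι] {X : ι → Ω → ℝ} {α b m : ι → ℝ}

theorem charFun_map_sum_of_isPearson (hX : ∀ i, IsPearson (X i) (α i) (b i) (m i) P)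
    (hind : iIndepFun X P) (t : ℝ) :
    charFun (P.map fun ω => ∑ i, X i ω) t = Complex.exp (t * (∑ i, m i : ℝ) * Complex.I) *
      ∏ i, ((b i : ℂ) / (b i - t * Complex.I)) ^ (α i : ℂ) := by
  rw [hind.charFun_map_fun_sum_eq_prod fun i => (hX i).2.2.2.2.aemeasurable, Finset.prod_apply,
    Complex.ofReal_sum, Finset.mul_sum, Finset.sum_mul, Complex.exp_sum,
    ← Finset.prod_mul_distrib]
  refine Finset.prod_congr rfl fun i _ => ?_
  obtain ⟨hα, hb, hpdf⟩ := hX i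
  rw [hpdf.charFun_eq, densityCharFun_pearsonPDF hα hb]

theorem prod_cpow_eq_cpow_sum {κ : Type*} (s : Finset κ) (c : κ → ℂ) {z : ℂ} (hz : z ≠ 0) :
    ∏ i ∈ s, z ^ c i = z ^ ∑ i ∈ s, c i := by
  induction s using Finset.cons_induction with
  | empty => rw [Finset.prod_empty, Finset.sum_empty, Complex.cpow_zero]
  | cons i s hi ih => rw [Finset.prod_cons, Finset.sum_cons, Complex.cpow_add _ _ hz, ih]

theorem aemeasurable_sum_of_isPearson (hX : ∀ i, IsPearson (X i) (α i) (b i) (m i) P) :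
    AEMeasurable (fun ω => ∑ i, X i ω) P :=
  Finset.aemeasurable_fun_sum _ fun i _ => (hX i).2.2.2.2.aemeasurable

theorem IsPearson.sum [Nonempty ι] {β : ℝ} (hX : ∀ i, IsPearson (X i) (α i) β (m i) P)
    (hind : iIndepFun X P) :
    IsPearson (fun ω => ∑ i, X i ω) (∑ i, α i) β (∑ i, m i) P := by
  have := hind.isProbabilityMeasure
  obtain ⟨-, hβ, -⟩ := hX (Classical.arbitrary ι)
  have hα : 0 < ∑ i, α i := Finset.sum_pos (fun i _ => (hX i).1) Finset.univ_nonempty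
  refine ⟨hα, hβ, HasRealPDF.of_charFun_eq (aemeasurable_sum_of_isPearson hX)
    (measurable_pearsonPDF _ _ _) (integrable_pearsonPDF hα hβ _)
    (isOpen_setOf_lt_of_continuousOn_compl (continuousOn_pearsonPDF _ hβ _)
      (pearsonPDF_self _ _ _).ge) (funext fun t => ?_)⟩
  have hbase : (β : ℂ) / (β - t * Complex.I) ≠ 0 := div_ne_zero (mod_cast hβ)
    (ofReal_sub_ne_zero_of_re_ne (by simpa using hβ.symm))
  rw [charFun_map_sum_of_isPearson hX hind, prod_cpow_eq_cpow_sum _ _ hbase,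
    ← Complex.ofReal_sum, densityCharFun_pearsonPDF hα hβ]

theorem hasRealPDF_sum_of_injective {n : ℕ} {X : Fin (n + 1) → Ω → ℝ} {a : Fin (n + 1) → ℕ}
    {b m : Fin (n + 1) → ℝ} (hX : ∀ i, IsPearson (X i) (a i) (b i) (m i) P)
    (hind : iIndepFun X P) (hb : Function.Injective b) :
    HasRealPDF (fun ω => ∑ i, X i ω)
      (fun x => ∑ i, ∑ k ∈ Finset.Icc 1 (a i),
        Xi0 a b i k * pearsonPDF (k : ℝ) (b i) (∑ q, m q) x) P := by
  have := hind.isProbabilityMeasure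
  have ha (i : Fin (n + 1)) : 0 < a i := Nat.cast_pos.1 (hX i).1
  have hb0 (i : Fin (n + 1)) : b i ≠ 0 := (hX i).2.1
  simp_rw [Finset.sum_sigma']
  refine HasRealPDF.sum_mul_pearsonPDF_of_charFun_eq (aemeasurable_sum_of_isPearson hX)
    (fun p hp => Nat.cast_pos.2 (Finset.mem_Icc.1 (Finset.mem_sigma.1 hp).2).1)
    (fun p _ => hb0 p.1) fun t => ?_
  have hne (i : Fin (n + 1)) : -(t * Complex.I) + algebraMap ℝ ℂ (b i) ≠ 0 := by
    rw [neg_add_eq_sub]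
    exact ofReal_sub_ne_zero_of_re_ne (by simpa using (hb0 i).symm)
  have hfrac := prod_div_pow_eq_sum_Xi0 ha hb0 hb hne
  simp_rw [neg_add_eq_sub, Complex.coe_algebraMap] at hfrac
  simp_rw [charFun_map_sum_of_isPearson hX hind, Complex.ofReal_natCast, Complex.cpow_natCast,
    hfrac, Finset.sum_sigma']

end Sums

theorem mainTheorem1_general {Ω : Type*} [MeasurableSpace Ω] (P : Measure Ω) (n : ℕ)
    (X : Fin (n + 1) → Ω → ℝ) (α b m : Fin (n + 1) → ℝ)
    (hX : ∀ i, IsPearson (X i) (α i) (b i) (m i) P) (hind : iIndepFun X P) :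
    (∀ β : ℝ, (∀ i, b i = β) →
      IsPearson (fun ω => ∑ i, X i ω) (∑ i, α i) β (∑ i, m i) P) ∧
    (∀ a : Fin (n + 1) → ℕ, (∀ i, α i = a i) → (∀ i j, i ≠ j → b i ≠ b j) →
      HasRealPDF (fun ω => ∑ i, X i ω)
        (fun x => ∑ i, ∑ k ∈ Finset.Icc 1 (a i),
          Xi0 a b i k * pearsonPDF (k : ℝ) (b i) (∑ q, m q) x) P ∧
      (∀ i, Xi0 a b i (a i) =
        (∏ w, b w ^ a w) / b i ^ a i *
          ∏ j ∈ Finset.univ.erase i, (b j - b i) ^ (-(a j : ℤ))) ∧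
      (∀ i, ∀ k : ℕ, 1 ≤ k → k < a i →
        Xi0 a b i (a i - k) =
          1 / (k : ℝ) * ∑ j ∈ Finset.Icc 1 k, ∑ q ∈ Finset.univ.erase i,
            (a q : ℝ) * b i ^ j * (b i - b q) ^ (-(j : ℤ)) * Xi0 a b i (a i - k + j))) := by
  constructor
  · intro β hβ
    obtain rfl : b = fun _ => β := funext hβ
    exact IsPearson.sum hX hind
  · intro a hα hb
    obtain rfl : α = fun i => (a i : ℝ) := funext hα
    have ha (i : Fin (n + 1)) : 0 < a i := Nat.cast_pos.1 (hX i).1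
    have hinj : Function.Injective b := fun i j => not_imp_not.1 (hb i j)
    exact ⟨hasRealPDF_sum_of_injective hX hind hinj, Xi0_self ha,
      fun i k hk hka => Xi0_recursion ha (hX i).2.1 (Nat.one_le_iff_ne_zero.1 hk) hka.le⟩

theorem mainTheorem1 {Ω : Type*} [MeasurableSpace Ω] (P : Measure Ω) [IsProbabilityMeasure P]
    (n : ℕ) (X : Fin (n + 1) → Ω → ℝ) (a : Fin (n + 1) → ℕ) (b m : Fin (n + 1) → ℝ)
    (ha : ∀ i, 0 < a i) (hb : (∀ i, 0 < b i) ∨ (∀ i, b i < 0))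
    (hX : ∀ i, IsPearson (X i) (a i) (b i) (m i) P) (hind : iIndepFun X P) :
    (∀ β : ℝ, (∀ i, b i = β) →
      IsPearson (fun ω => ∑ i, X i ω) ((∑ i, a i : ℕ) : ℝ) β (∑ i, m i) P) ∧
    ((∀ i j, i ≠ j → b i ≠ b j) →
      HasRealPDF (fun ω => ∑ i, X i ω)
        (fun x => ∑ i, ∑ k ∈ Finset.Icc 1 (a i),
          Xi0 a b i k * pearsonPDF (k : ℝ) (b i) (∑ q, m q) x) P ∧
      (∀ i, Xi0 a b i (a i) =
        (∏ w, b w ^ a w) / b i ^ a i *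
          ∏ j ∈ Finset.univ.erase i, (b j - b i) ^ (-(a j : ℤ))) ∧
      (∀ i, ∀ k : ℕ, 1 ≤ k → k < a i →
        Xi0 a b i (a i - k) =
          1 / (k : ℝ) * ∑ j ∈ Finset.Icc 1 k, ∑ q ∈ Finset.univ.erase i,
            (a q : ℝ) * b i ^ j * (b i - b q) ^ (-(j : ℤ)) * Xi0 a b i (a i - k + j))) := by
  have h := mainTheorem1_general P n X (fun i => (a i : ℝ)) b m hX hind
  exact ⟨by simpa only [Nat.cast_sum] using h.1, h.2 a fun _ => rfl⟩
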